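/- Let $i,j$ be real numbers with $0<i,j<1$ and $i+j=1$, and let $\gamma,\delta\in\mathbb R$. Write $\|t\|$ for the distance from a real number $t$ to the nearest integer, and let $\mathbf{Bad}_{(\gamma,\delta)}(i,j)$ be the set of points $(x,y)\in\mathbb R^2$ for which there is a constant $c=c(x,y)>0$ such that $$\max\{\|qx-\gamma\|^{1/i},\ \|qy-\delta\|^{1/j}\}>c\,q^{-1}\qquad\text{for all positive integers } q.$$ Then $\mathbf{Bad}_{(\gamma,\delta)}(i,j)$ is a $(30\sqrt2)^{-1}$-winning subset of $\mathbb R^2$. Here, for $0<\alpha<1$, a set $X\subset\mathbb R^2$ is called $\alpha$-winning if for every $\beta\in(0,1)$ player A has a strategy in the following game which guarantees victory however player B plays. Player B first chooses a closed Euclidean disc $B_0\subset\mathbb R^2$ of positive radius; then, alternately for $n=0,1,2,\dots$, player A chooses a closed disc $A_n\subset B_n$ whose diameter is $\alpha$ times that of $B_n$, and player B chooses a closed disc $B_{n+1}\subset A_n$ whose diameter is $\beta$ times that of $A_n$. Player A wins if the unique point of $\bigcap_n B_n=\bigcap_n A_n$ lies in $X$. -/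

import Mathlib

namespace SchmidtGame

/-- A closed (nondegenerate) Euclidean ball in `ℝ^m`, recorded by its centre and radius. -/
structure Ball (m : ℕ) where
  center : EuclideanSpace ℝ (Fin m)
  radius : ℝ
  radius_pos : 0 < radius

/-- The set of points of a closed ball. -/
def Ball.toSet {m : ℕ} (b : Ball m) : Set (EuclideanSpace ℝ (Fin m)) :=
  Metric.closedBall b.center b.radius

/-- `b'` is a legal reply to `b` with ratio `t`: the ball `b'` is contained in `b`, and its
radius (equivalently, its diameter) is `t` times that of `b`. -/
def IsReply {m : ℕ} (t : ℝ) (b b' : Ball m) : Prop :=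
  b'.toSet ⊆ b.toSet ∧ b'.radius = t * b.radius

/-- A strategy for the second player (player A): it answers the balls `B 0, …, B n` chosen so far
by the first player (player B) with the ball `A n`. -/
def Strategy (m : ℕ) : Type :=
  (n : ℕ) → (Fin (n + 1) → Ball m) → Ball m

/-- The ball `A n` chosen by player A, who follows `σ`, when player B plays `B 0, B 1, …`. -/
def Strategy.move {m : ℕ} (σ : Strategy m) (B : ℕ → Ball m) (n : ℕ) : Ball m :=
  σ n (fun k => B k)

/-- `X` is `(α, β)`-winning: player A has a strategy such that, whenever all moves of player B are
legal (`B 0` is arbitrary, `B (n + 1)` lies in `A n` and has radius `β` times the radius of `A n`),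
all moves of player A are legal (`A n` lies in `B n` and has radius `α` times the radius of `B n`)
and the balls meet in a single point, which lies in `X`. -/
def IsWinningPair {m : ℕ} (α β : ℝ) (X : Set (EuclideanSpace ℝ (Fin m))) : Prop :=
  ∃ σ : Strategy m, ∀ B : ℕ → Ball m,
    (∀ n, IsReply β (σ.move B n) (B (n + 1))) →
      (∀ n, IsReply α (B n) (σ.move B n)) ∧
        ∃ x ∈ X, (⋂ n, (B n).toSet) = {x} ∧ (⋂ n, (σ.move B n).toSet) = {x}

/-- `X` is `α`-winning (for `0 < α < 1`): it is `(α, β)`-winning for all `β ∈ (0, 1)`. -/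
def IsWinning {m : ℕ} (α : ℝ) (X : Set (EuclideanSpace ℝ (Fin m))) : Prop :=
  ∀ β : ℝ, 0 < β → β < 1 → IsWinningPair α β X

end SchmidtGame

/-- The distance of a real number to the nearest integer. -/
noncomputable def distNearestInt (t : ℝ) : ℝ := |t - round t|

/-- The set of inhomogeneously `(i, j)`-badly approximable points of the plane with respect to
`(γ, δ)`; the constant `c` may depend on the point. -/
def inhomBad (i j γ δ : ℝ) : Set (EuclideanSpace ℝ (Fin 2)) :=
  {p | ∃ c : ℝ, 0 < c ∧ ∀ q : ℕ, 0 < q →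
    max (distNearestInt (q * p 0 - γ) ^ (1 / i)) (distNearestInt (q * p 1 - δ) ^ (1 / j)) > c / q}

namespace SchmidtGame

open scoped ENNReal

/-! ### Nested balls of a play -/

section Nested

variable {m : ℕ} {α β : ℝ} {B A : ℕ → Ball m}

/-! The proof separates a game with strips from Diophantine geometry. Put R = 1/(αβ), so radii
shrink by R per round.

Game (`exists_strategy_avoiding_strips`): each ball of player B prescribes countably many strips,
thin relative to its radius. A thin strip misses one of three candidate replies, so A takes the
candidate of least potential, a weighted count of the strips still met. The potential then stays at
most 1/2, whereas a strip containing the outcome would contribute unboundedly.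

Homogeneous part: the pigeonhole principle puts each rational point (p/q, r/q) on a line Ax + By + C
= 0 with |A| ≤ q^i, |B| ≤ q^j. Its height is H = q max(|A|,|B|), its excess K = q^(1+max(i,j))/H.
Points are sorted into dyadic classes of K and treated in balls of radius about σ max(1,
cK^min(i,j))/H. Dangerous points of one class in one ball lie on a common line
(`AtScale.on_line_of_near`): otherwise two such lines would meet in a rational point of smaller
denominator approximating (x, y) too well, or a nonzero integer would be less than 1. Hence one
strip per class suffices, with relative width √c times a geometric factor (`exists_line_cover`), and
induction on q makes the outcome homogeneously bad.

Inhomogeneous part: the difference of two inhomogeneous approximations is a homogeneous one,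
excluded by the first part. So each ball meets at most one relevant inhomogeneous box, and one more
strip covers it (`exists_line_cover_inhom`). Both families of strips are avoided in the same play.
-/

theorem radius_eq_of_isReply (hA : ∀ n, IsReply α (B n) (A n))
    (hB : ∀ n, IsReply β (A n) (B (n + 1))) (n : ℕ) :
    (B n).radius = (α * β) ^ n * (B 0).radius := by
  induction n with
  | zero => simp
  | succ n ih => rw [(hB n).2, (hA n).2, ih]; ring

/-- The balls of a play shrink to a single point. -/
theorem exists_iInter_eq_singleton (hα : 0 < α) (hβ : 0 < β) (h1 : α * β < 1)
    (hA : ∀ n, IsReply α (B n) (A n)) (hB : ∀ n, IsReply β (A n) (B (n + 1))) :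
    ∃ x, (⋂ n, (B n).toSet) = {x} ∧ (⋂ n, (A n).toSet) = {x} := by
  have hmono : ∀ n, (B (n + 1)).toSet ⊆ (B n).toSet := fun n => (hB n).1.trans (hA n).1
  obtain ⟨x, hx⟩ := IsCompact.nonempty_iInter_of_sequence_nonempty_isCompact_isClosed
    (fun n => (B n).toSet) hmono
    (fun n => ⟨(B n).center, Metric.mem_closedBall_self (B n).radius_pos.le⟩)
    (isCompact_closedBall _ _) (fun n => Metric.isClosed_closedBall)
  have hBx : (⋂ n, (B n).toSet) = {x} := by
    refine Set.eq_singleton_iff_unique_mem.2 ⟨hx, fun y hy => ?_⟩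
    rw [Set.mem_iInter] at hx hy
    have hlim : Filter.Tendsto (fun n => 2 * ((α * β) ^ n * (B 0).radius)) Filter.atTop
        (nhds (2 * (0 * (B 0).radius))) :=
      ((tendsto_pow_atTop_nhds_zero_of_lt_one (mul_pos hα hβ).le h1).mul_const _).const_mul _
    have hle : dist y x ≤ 2 * (0 * (B 0).radius) := ge_of_tendsto' hlim fun n => by
      rw [← radius_eq_of_isReply hA hB n]
      have h1 := Metric.mem_closedBall.1 (hx n)
      have h2 := Metric.mem_closedBall.1 (hy n)
      linarith [dist_triangle_right y x (B n).center]
    exact dist_le_zero.1 (by simpa using hle)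
  refine ⟨x, hBx, ?_⟩
  rw [← hBx]
  refine Set.Subset.antisymm (Set.iInter_mono fun n => (hA n).1) ?_
  exact Set.subset_iInter fun n => (Set.iInter_subset _ (n + 1)).trans (hB n).1

end Nested

/-- It suffices to find a strategy against every fixed first ball. -/
theorem isWinningPair_of_forall_ball {m : ℕ} {α β : ℝ} {X : Set (EuclideanSpace ℝ (Fin m))}
    (h : ∀ b : Ball m, ∃ σ : Strategy m, ∀ B : ℕ → Ball m, B 0 = b →
      (∀ n, IsReply β (σ.move B n) (B (n + 1))) →
      (∀ n, IsReply α (B n) (σ.move B n)) ∧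
        ∃ x ∈ X, (⋂ n, (B n).toSet) = {x} ∧ (⋂ n, (σ.move B n).toSet) = {x}) :
    IsWinningPair α β X := by
  choose σ hσ using h
  exact ⟨fun n H => σ (H 0) n H, fun B hB => hσ (B 0) B rfl hB⟩

/-! ### Strips and candidate replies -/

theorem abs_apply_sub_le {m : ℕ} {b : Ball m} {x : EuclideanSpace ℝ (Fin m)} (hx : x ∈ b.toSet)
    (t : Fin m) : |x t - b.center t| ≤ b.radius := by
  have h := PiLp.norm_apply_le (x - b.center) t
  rw [PiLp.sub_apply, Real.norm_eq_abs] at h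
  exact h.trans (mem_closedBall_iff_norm.1 hx)

/-- Three balls of ratio `α` inside a given ball, in general position. -/
noncomputable def candidate (α : ℝ) (hα : 0 < α) (b : Ball 2) (t : Option (Fin 2)) : Ball 2 where
  center := b.center + (b.radius / 2) • t.elim 0 fun u => EuclideanSpace.single u (1 : ℝ)
  radius := α * b.radius
  radius_pos := mul_pos hα b.radius_pos

theorem isReply_candidate {α : ℝ} (hα : 0 < α) (hα' : α ≤ 1 / 2) (b : Ball 2)
    (t : Option (Fin 2)) : IsReply α b (candidate α hα b t) := by
  refine ⟨Metric.closedBall_subset_closedBall' ?_, rfl⟩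
  have hb := b.radius_pos
  have h : ‖(b.radius / 2) • t.elim 0 fun u => EuclideanSpace.single u (1 : ℝ)‖ ≤
      b.radius / 2 := by
    rw [norm_smul, Real.norm_of_nonneg (by positivity)]
    rcases t with _ | t
    · simpa using (half_pos hb).le
    · simp
  simp only [candidate, dist_self_add_left]
  nlinarith

/-- The ball `b` meets the strip of half-width `ε` about the line with coefficients `l`. -/
def MeetsStrip (l : ℝ × ℝ × ℝ) (ε : ℝ) (b : Ball 2) : Prop :=
  ∃ x ∈ b.toSet, |l.1 * x 0 + l.2.1 * x 1 + l.2.2| ≤ ε * max |l.1| |l.2.1|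

theorem MeetsStrip.mono {l : ℝ × ℝ × ℝ} {ε : ℝ} {b b' : Ball 2} (h : MeetsStrip l ε b')
    (hb : b'.toSet ⊆ b.toSet) : MeetsStrip l ε b :=
  let ⟨x, hx, hx'⟩ := h
  ⟨x, hb hx, hx'⟩

theorem MeetsStrip.abs_center_le {l : ℝ × ℝ × ℝ} {ε : ℝ} {b : Ball 2} (h : MeetsStrip l ε b) :
    |l.1 * b.center 0 + l.2.1 * b.center 1 + l.2.2| ≤
      (ε + 2 * b.radius) * max |l.1| |l.2.1| := by
  obtain ⟨x, hx, h⟩ := h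
  have h0 := abs_apply_sub_le hx 0
  have h1 := abs_apply_sub_le hx 1
  have e0 : |l.1 * (x 0 - b.center 0)| ≤ max |l.1| |l.2.1| * b.radius := by
    rw [abs_mul]; gcongr; exact le_max_left _ _
  have e1 : |l.2.1 * (x 1 - b.center 1)| ≤ max |l.1| |l.2.1| * b.radius := by
    rw [abs_mul]; gcongr; exact le_max_right _ _
  rw [abs_le] at *
  constructor <;> linarith [e0.1, e0.2, e1.1, e1.2, h.1, h.2]

/-- A thin strip misses one of the three candidates. -/
theorem exists_not_meetsStrip_candidate {α : ℝ} (hα : 0 < α) (hα' : α ≤ 1 / 40) (b : Ball 2)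
    {l : ℝ × ℝ × ℝ} (hl : l.1 ≠ 0 ∨ l.2.1 ≠ 0) {ε : ℝ} (hε : 8 * ε < b.radius) :
    ∃ t, ¬ MeetsStrip l ε (candidate α hα b t) := by
  by_contra! h
  have hb := b.radius_pos
  have hn := (h none).abs_center_le
  have h0 := (h (some 0)).abs_center_le
  have h1 := (h (some 1)).abs_center_le
  have hm : 0 < max |l.1| |l.2.1| := by
    rcases hl with h | h
    · exact lt_max_of_lt_left (abs_pos.2 h)
    · exact lt_max_of_lt_right (abs_pos.2 h)
  simp [candidate] at hn h0 h1
  -- Here 1/8 + 2/40 < 1/4. Two centres differ by half a radius along an axis, so the two bounds on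
  -- the form force each coefficient to be strictly below the maximum of both.
  have hw : (ε + 2 * (α * b.radius)) < b.radius / 4 := by nlinarith
  have hw' := mul_lt_mul_of_pos_right hw hm
  have a0 : |l.1| * b.radius < max |l.1| |l.2.1| * b.radius := by
    rw [← abs_of_pos hb, ← abs_mul, abs_of_pos hb, abs_lt]
    rw [abs_le] at hn h0
    constructor <;> nlinarith [hn.1, hn.2, h0.1, h0.2]
  have a1 : |l.2.1| * b.radius < max |l.1| |l.2.1| * b.radius := by
    rw [← abs_of_pos hb, ← abs_mul, abs_of_pos hb, abs_lt]
    rw [abs_le] at hn h1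
    constructor <;> nlinarith [hn.1, hn.2, h1.1, h1.2]
  have := max_lt (lt_of_mul_lt_mul_right a0 hb.le) (lt_of_mul_lt_mul_right a1 hb.le)
  exact lt_irrefl _ this

/-! ### The potential and the avoidance strategy -/

section Potential

variable {ι : Type} (τ : ι → ℝ) (L : Ball 2 → ι → ℝ × ℝ × ℝ) (R η : ℝ)

open Classical in
/-- The potential at the ball `b` of the strips prescribed by `B 0, …, B n`. -/
noncomputable def potential (B : ℕ → Ball 2) (n : ℕ) (b : Ball 2) : ℝ≥0∞ :=
  -- In a play, `R ^ (n - m)` is the ratio of the radii of `B m` and `B n`. The base of the weight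
  -- is thus 8 times the half-width over the current radius, and a weight below 1 means that the
  -- strip is thin enough to miss a candidate.
  ∑ m ∈ Finset.range (n + 1), ∑' k, if MeetsStrip (L (B m) k) (τ k * (B m).radius) b then
    ENNReal.ofReal ((8 * τ k * R ^ (n - m)) ^ η) else 0

/-- Allows a strategy that sees only a finite history to minimise the potential. -/
theorem potential_congr {B B' : ℕ → Ball 2} {n : ℕ} (h : ∀ m ≤ n, B m = B' m) (b : Ball 2) :
    potential τ L R η B n b = potential τ L R η B' n b := by
  unfold potential
  refine Finset.sum_congr rfl fun m hm => ?_
  rw [h m (Nat.lt_succ_iff.1 (Finset.mem_range.1 hm))]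

variable {τ L R η}

/-- A smaller ball meets fewer of the old strips, whose weights grow by R^η = 5/4; the new strips
weigh at most 1/12 in total. -/
theorem potential_succ_le (hR : 0 < R) (hη : R ^ η = 5 / 4) (hτ : ∀ k, 0 < τ k)
    (hsum : ∑' k, ENNReal.ofReal ((8 * τ k) ^ η) ≤ 1 / 12) {B : ℕ → Ball 2} {n : ℕ}
    {b b' : Ball 2} (hb : b'.toSet ⊆ b.toSet) :
    potential τ L R η B (n + 1) b' ≤ ENNReal.ofReal (5 / 4) * potential τ L R η B n b + 1 / 12 := by
  classical
  unfold potential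
  rw [Finset.sum_range_succ]
  refine add_le_add ?_ ((ENNReal.tsum_le_tsum fun k => ?_).trans hsum)
  · rw [Finset.mul_sum]
    refine Finset.sum_le_sum fun m hm => ?_
    rw [← ENNReal.tsum_mul_left]
    refine ENNReal.tsum_le_tsum fun k => ?_
    split_ifs with h1 h2
    · rw [← ENNReal.ofReal_mul (by norm_num), ← hη,
        ← Real.mul_rpow hR.le (by have := hτ k; positivity),
        Nat.succ_sub (Nat.lt_succ_iff.1 (Finset.mem_range.1 hm)), pow_succ]
      refine le_of_eq ?_
      congr 2; ring
    · exact absurd (h1.mono hb) h2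
    · exact zero_le
    · exact zero_le
  · split_ifs <;> simp

theorem potential_zero_le (hsum : ∑' k, ENNReal.ofReal ((8 * τ k) ^ η) ≤ 1 / 12) {B : ℕ → Ball 2}
    {b : Ball 2} : potential τ L R η B 0 b ≤ 1 / 12 := by
  classical
  unfold potential
  rw [Finset.sum_range_one]
  refine (ENNReal.tsum_le_tsum fun k => ?_).trans hsum
  split_ifs <;> simp

theorem le_potential {B : ℕ → Ball 2} {m n : ℕ} (hmn : m ≤ n) {k : ι} {b : Ball 2}
    (h : MeetsStrip (L (B m) k) (τ k * (B m).radius) b) :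
    ENNReal.ofReal ((8 * τ k * R ^ (n - m)) ^ η) ≤ potential τ L R η B n b := by
  classical
  unfold potential
  refine le_trans ?_ (Finset.single_le_sum (fun _ _ => zero_le)
    (Finset.mem_range.2 (Nat.lt_succ_iff.2 hmn)))
  refine le_trans ?_ (ENNReal.le_tsum k)
  rw [if_pos h]

/-- Potential below 1 makes every strip meeting the ball thin, so each such strip meets at most two
of the three candidates. The best candidate therefore keeps at most 2/3 of the potential. -/
theorem sum_potential_candidate_le {α : ℝ} (hα : 0 < α) (hα' : α ≤ 1 / 40)
    (hη : 0 < η) (hL : ∀ b k, (L b k).1 ≠ 0 ∨ (L b k).2.1 ≠ 0)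
    {B : ℕ → Ball 2} {n : ℕ} (hrad : ∀ m ≤ n, (B m).radius = R ^ (n - m) * (B n).radius)
    (hpot : potential τ L R η B n (B n) < 1) :
    ∑ t, potential τ L R η B n (candidate α hα (B n) t) ≤ 2 * potential τ L R η B n (B n) := by
  classical
  have hle : ∀ m ≤ n, ∀ k, MeetsStrip (L (B m) k) (τ k * (B m).radius) (B n) →
      8 * (τ k * (B m).radius) < (B n).radius := fun m hm k h => by
    have h1 := (le_potential (R := R) (η := η) hm h).trans_lt hpot
    rw [ENNReal.ofReal_lt_one] at h1
    have h2 : 8 * τ k * R ^ (n - m) < 1 := by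
      by_contra! h3
      exact absurd (Real.one_le_rpow h3 hη.le) (not_le.2 h1)
    rw [hrad m hm]
    nlinarith [(B n).radius_pos]
  conv_lhs => unfold potential
  rw [Finset.sum_comm]
  unfold potential
  rw [Finset.mul_sum]
  refine Finset.sum_le_sum fun m hm => ?_
  have hmn := Nat.lt_succ_iff.1 (Finset.mem_range.1 hm)
  rw [← ENNReal.tsum_mul_left, ← Summable.tsum_finsetSum fun _ _ => ENNReal.summable]
  refine ENNReal.tsum_le_tsum fun k => ?_
  by_cases hk : MeetsStrip (L (B m) k) (τ k * (B m).radius) (B n)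
  · obtain ⟨t, ht⟩ := exists_not_meetsStrip_candidate hα hα' (B n) (hL (B m) k) (hle m hmn k hk)
    rw [if_pos hk, ← Finset.add_sum_erase _ _ (Finset.mem_univ t), if_neg ht, zero_add]
    refine (Finset.sum_le_card_nsmul _ _ (ENNReal.ofReal ((8 * τ k * R ^ (n - m)) ^ η))
      fun u _ => ?_).trans ?_
    · split_ifs <;> simp
    · simp [Finset.card_erase_of_mem]
  · refine le_of_eq_of_le (Finset.sum_eq_zero fun t _ => if_neg fun h => hk ?_) zero_le
    exact h.mono (isReply_candidate hα (by linarith) _ t).1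

/-- Player A can avoid countably many strips prescribed at every stage, if they are thin enough. -/
theorem exists_strategy_avoiding_strips {α β : ℝ} (hα : 0 < α) (hα' : α ≤ 1 / 40) (hβ : 0 < β)
    (hβ' : β < 1) (hη : 0 < η) (hRη : (α * β)⁻¹ ^ η = 5 / 4)
    (hL : ∀ b k, (L b k).1 ≠ 0 ∨ (L b k).2.1 ≠ 0) (hτ : ∀ k, 0 < τ k)
    (hsum : ∑' k, ENNReal.ofReal ((8 * τ k) ^ η) ≤ 1 / 12) :
    ∃ σ : Strategy 2, ∀ B : ℕ → Ball 2, (∀ n, IsReply β (σ.move B n) (B (n + 1))) →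
      (∀ n, IsReply α (B n) (σ.move B n)) ∧ ∀ x, (∀ n, x ∈ (B n).toSet) → ∀ m k,
        τ k * (B m).radius * max |(L (B m) k).1| |(L (B m) k).2.1| <
          |(L (B m) k).1 * x 0 + (L (B m) k).2.1 * x 1 + (L (B m) k).2.2| := by
  have hR : 1 < (α * β)⁻¹ := (one_lt_inv₀ (by positivity)).2 (by nlinarith)
  have hR0 : 0 < (α * β)⁻¹ := by linarith
  set R := (α * β)⁻¹ with hRdef
  have hmin : ∀ (n : ℕ) (B : ℕ → Ball 2), ∃ t, ∀ u,
      potential τ L R η B n (candidate α hα (B n) t) ≤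
        potential τ L R η B n (candidate α hα (B n) u) := fun n B => Finite.exists_min _
  choose pick hpick using hmin
  let ext : (n : ℕ) → (Fin (n + 1) → Ball 2) → ℕ → Ball 2 :=
    -- The finite history is continued by its last ball; the potential at stage n does not see the
    -- continuation.
    fun n H m => H ⟨min m n, by omega⟩
  refine ⟨fun n H => candidate α hα (H (Fin.last n)) (pick n (ext n H)), fun B hB => ?_⟩
  set σ : Strategy 2 := fun n H => candidate α hα (H (Fin.last n)) (pick n (ext n H))
  have hA : ∀ n, IsReply α (B n) (σ.move B n) := fun n => by
    simpa [σ, Strategy.move] using isReply_candidate hα (by linarith) (B n) _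
  have hmove : ∀ n u, potential τ L R η B n (σ.move B n) ≤
      potential τ L R η B n (candidate α hα (B n) u) := fun n u => by
    have h1 := hpick n (ext n fun k => B k) u
    have h2 : ∀ m ≤ n, ext n (fun k => B k) m = B m := fun m hm => by simp [ext, hm]
    rw [h2 n le_rfl, potential_congr τ L R η h2, potential_congr τ L R η h2] at h1
    simpa [σ, Strategy.move] using h1
  have hrad : ∀ n, ∀ m ≤ n, (B m).radius = R ^ (n - m) * (B n).radius := fun n m hm => by
    obtain ⟨d, rfl⟩ := Nat.exists_eq_add_of_le hm
    rw [radius_eq_of_isReply hA hB, radius_eq_of_isReply hA hB (m + d), hRdef, pow_add,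
      Nat.add_sub_cancel_left, inv_pow]
    have : (α * β) ^ d ≠ 0 := by positivity
    field_simp
  -- The bound reproduces itself: (5/4) · (2/3) · (1/2) + 1/12 = 1/2.
  have hpot : ∀ n, potential τ L R η B n (B n) ≤ 1 / 2 := fun n => by
    induction n with
    | zero =>
      refine (potential_zero_le hsum).trans ?_
      simp only [one_div]
      exact ENNReal.inv_le_inv.2 (by norm_num)
    | succ n ih =>
      have hlt : potential τ L R η B n (B n) < 1 := ih.trans_lt (by simp)
      have h3 : 3 * potential τ L R η B n (σ.move B n) ≤ 1 := by
        have h := Finset.card_nsmul_le_sum Finset.univ _ _ fun u _ => hmove n u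
        have h4 := h.trans (sum_potential_candidate_le hα hα' hη hL (hrad n) hlt)
        refine le_trans ?_ (h4.trans (mul_le_mul_right ih 2))  |>.trans ?_
        · simp
        · simp [ENNReal.mul_inv_cancel]
      refine (potential_succ_le hR0 hRη hτ hsum (hB n).1).trans ?_
      have h5 : potential τ L R η B n (σ.move B n) ≤ ENNReal.ofReal (1 / 3) := by
        rw [one_div, ENNReal.ofReal_inv_of_pos (by norm_num)]
        rw [ENNReal.le_inv_iff_mul_le, mul_comm]
        simpa using h3
      calc _ ≤ ENNReal.ofReal (5 / 4) * ENNReal.ofReal (1 / 3) + ENNReal.ofReal (1 / 12) := by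
            gcongr
            rw [ENNReal.ofReal_div_of_pos (by norm_num)]; simp
        _ = ENNReal.ofReal (1 / 2) := by
            rw [← ENNReal.ofReal_mul (by norm_num), ← ENNReal.ofReal_add (by norm_num)
              (by norm_num)]
            norm_num
        _ ≤ _ := by rw [ENNReal.ofReal_div_of_pos (by norm_num)]; simp
  refine ⟨hA, fun x hx m k => ?_⟩
  by_contra! hk
  have h8 := hτ k
  -- A strip containing the outcome meets every later ball, so its weight gains a factor 5/4 each
  -- round under a bounded potential.
  have hge : ∀ d : ℕ, (8 * τ k) ^ η * (5 / 4 : ℝ) ^ d ≤ 1 / 2 := fun d => by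
    have h1 := (le_potential (R := R) (η := η) (Nat.le_add_right m d) (L := L) (τ := τ) (B := B)
      (k := k) ⟨x, hx (m + d), hk⟩).trans (hpot (m + d))
    rw [Nat.add_sub_cancel_left, Real.mul_rpow (by positivity) (by positivity),
      ← Real.rpow_natCast R, ← Real.rpow_mul hR0.le, mul_comm (d : ℝ), Real.rpow_mul hR0.le, hRη,
      Real.rpow_natCast] at h1
    have h2 : (1 / 2 : ℝ≥0∞) = ENNReal.ofReal (1 / 2) := by
      rw [ENNReal.ofReal_div_of_pos (by norm_num)]; simp
    rw [h2] at h1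
    exact (ENNReal.ofReal_le_ofReal_iff (by norm_num)).1 h1
  obtain ⟨d, hd⟩ := pow_unbounded_of_one_lt (1 / (8 * τ k) ^ η) (by norm_num : (1 : ℝ) < 5 / 4)
  have hpos : 0 < (8 * τ k) ^ η := by positivity
  rw [div_lt_iff₀ hpos] at hd
  linarith [hge d]

end Potential

end SchmidtGame

/-! ### Rational points, their lines, height and excess -/

/-- `(x, y)` is approximated by `(p / q, r / q)` within the weighted box of size `c`. -/
def WeightedNear (i j c q p r x y : ℝ) : Prop :=
  |q * x - p| ≤ c * q ^ (-i) ∧ |q * y - r| ≤ c * q ^ (-j)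

/-- A rational point `(p / q, r / q)` with a rational line `A x + B y + C = 0` of small height
through it. -/
structure RatPointOnLine (i j : ℝ) where
  (q : ℕ) (p r A B C : ℤ)
  q_pos : 0 < q
  on_line : A * p + B * r + C * q = 0
  abs_A_le : (|A| : ℝ) ≤ (q : ℝ) ^ i
  abs_B_le : (|B| : ℝ) ≤ (q : ℝ) ^ j
  ne_zero : A ≠ 0 ∨ B ≠ 0

/-- Pigeonhole: more than q^i · q^j = q pairs (u, v) are available, so two of them give the same
residue of up + vr modulo q; their difference supplies A and B. -/
theorem exists_ratPointOnLine {i j : ℝ} (hij : i + j = 1) {q : ℕ}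
    (hq : 0 < q) (p r : ℤ) : ∃ v : RatPointOnLine i j, v.q = q ∧ v.p = p ∧ v.r = r := by
  have hq0 : (0 : ℝ) < q := by exact_mod_cast hq
  have : NeZero q := ⟨hq.ne'⟩
  set a := ⌊(q : ℝ) ^ i⌋₊
  set b := ⌊(q : ℝ) ^ j⌋₊
  have ha : (a : ℝ) ≤ (q : ℝ) ^ i := Nat.floor_le (by positivity)
  have hb : (b : ℝ) ≤ (q : ℝ) ^ j := Nat.floor_le (by positivity)
  have hcard : q < (a + 1) * (b + 1) := by
    have h1 : (q : ℝ) ^ i < a + 1 := Nat.lt_floor_add_one _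
    have h2 : (q : ℝ) ^ j < b + 1 := Nat.lt_floor_add_one _
    have h3 : (q : ℝ) = (q : ℝ) ^ i * (q : ℝ) ^ j := by
      rw [← Real.rpow_add hq0, hij, Real.rpow_one]
    have h4 : (q : ℝ) < (a + 1) * (b + 1) := by
      rw [h3]; exact mul_lt_mul'' h1 h2 (by positivity) (by positivity)
    exact_mod_cast h4
  obtain ⟨⟨u, v⟩, huv, ⟨u', v'⟩, huv', hne, heq⟩ :=
    Finset.exists_ne_map_eq_of_card_lt_of_maps_to
      (s := Finset.range (a + 1) ×ˢ Finset.range (b + 1)) (t := (Finset.univ : Finset (ZMod q)))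
      (f := fun z => (z.1 * p + z.2 * r : ZMod q))
      (by simpa [ZMod.card] using hcard) (fun _ _ => Finset.mem_coe.2 (Finset.mem_univ _))
  simp only [Finset.mem_product, Finset.mem_range] at huv huv'
  have hdvd : (q : ℤ) ∣ ((u : ℤ) - u') * p + ((v : ℤ) - v') * r := by
    rw [← ZMod.intCast_zmod_eq_zero_iff_dvd]
    push_cast
    linear_combination heq
  obtain ⟨C, hC⟩ := hdvd
  refine ⟨⟨q, p, r, u - u', v - v', -C, hq, by rw [hC]; ring, ?_, ?_, ?_⟩, rfl, rfl, rfl⟩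
  · refine le_trans ?_ ha
    have : |(u : ℤ) - u'| ≤ a := abs_le.2 (by omega)
    exact_mod_cast this
  · refine le_trans ?_ hb
    have : |(v : ℤ) - v'| ≤ b := abs_le.2 (by omega)
    exact_mod_cast this
  · by_contra! h
    exact hne (Prod.ext (by simpa using sub_eq_zero.1 h.1) (by simpa using sub_eq_zero.1 h.2))

namespace RatPointOnLine

variable {i j : ℝ} (v w : RatPointOnLine i j)

/-- The height of a rational point with respect to its line. -/
noncomputable def height : ℝ := v.q * max |(v.A : ℝ)| |(v.B : ℝ)|

/-- The ratio of the largest possible height to the height. -/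
noncomputable def excess : ℝ := (v.q : ℝ) ^ (1 + max i j) / v.height

/-- The linear form defining the line. -/
def form (x y : ℝ) : ℝ := v.A * x + v.B * y + v.C

theorem one_le_q : (1 : ℝ) ≤ v.q := by exact_mod_cast v.q_pos

theorem q_pos' : (0 : ℝ) < v.q := by exact_mod_cast v.q_pos

theorem on_line' : (v.A * v.p + v.B * v.r + v.C * v.q : ℝ) = 0 := by exact_mod_cast v.on_line

theorem one_le_max : 1 ≤ max |(v.A : ℝ)| |(v.B : ℝ)| := by
  rcases v.ne_zero with h | h
  · exact le_max_of_le_left (by exact_mod_cast Int.one_le_abs h)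
  · exact le_max_of_le_right (by exact_mod_cast Int.one_le_abs h)

theorem q_le_height : v.q ≤ v.height := le_mul_of_one_le_right v.q_pos'.le v.one_le_max

theorem height_pos : 0 < v.height := v.q_pos'.trans_le v.q_le_height

theorem excess_mul_height : v.excess * v.height = (v.q : ℝ) ^ (1 + max i j) :=
  div_mul_cancel₀ _ v.height_pos.ne'

theorem one_le_excess : 1 ≤ v.excess := by
  rw [excess, one_le_div v.height_pos, height, Real.rpow_add v.q_pos', Real.rpow_one]
  refine mul_le_mul_of_nonneg_left (max_le ?_ ?_) v.q_pos'.le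
  · exact v.abs_A_le.trans (Real.rpow_le_rpow_of_exponent_le v.one_le_q (le_max_left _ _))
  · exact v.abs_B_le.trans (Real.rpow_le_rpow_of_exponent_le v.one_le_q (le_max_right _ _))

theorem excess_pos : 0 < v.excess := zero_lt_one.trans_le v.one_le_excess

theorem excess_mul_max : v.excess * max |(v.A : ℝ)| |(v.B : ℝ)| = (v.q : ℝ) ^ max i j := by
  have h := v.excess_mul_height
  rw [Real.rpow_add v.q_pos', Real.rpow_one, height] at h
  exact mul_left_cancel₀ v.q_pos'.ne' (by linarith)

theorem excess_le (hi : 0 < i) (hj : 0 < j) (hij : i + j = 1) : v.excess ≤ v.q := by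
  refine (le_mul_of_one_le_right v.excess_pos.le v.one_le_max).trans ?_
  rw [v.excess_mul_max]
  conv_rhs => rw [← Real.rpow_one (v.q : ℝ)]
  exact Real.rpow_le_rpow_of_exponent_le v.one_le_q (max_le (by linarith) (by linarith))

variable {v w}

/-- The bracket is an integer measuring whether the point of `v` lies on the line of `w`; the right
side is small when (x, y) is near the point of `v`. -/
theorem form_mul_q (x y : ℝ) :
    v.q * w.form x y - (w.A * v.p + w.B * v.r + w.C * v.q) =
      w.A * (v.q * x - v.p) + w.B * (v.q * y - v.r) := by
  rw [form]; ring

/-- The coefficient bounds, moved from `w.q` to `v.q` at the cost of M, cancel the weights of the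
approximation. -/
theorem abs_mul_add_mul_le {c M : ℝ} (hi : (w.q : ℝ) ^ i ≤ M * v.q ^ i)
    (hj : (w.q : ℝ) ^ j ≤ M * v.q ^ j) {x y : ℝ}
    (h : WeightedNear i j c v.q v.p v.r x y) :
    |w.A * (v.q * x - v.p) + w.B * (v.q * y - v.r)| ≤ 2 * M * c := by
  have hq := v.q_pos'
  have h1 : |w.A * (v.q * x - v.p)| ≤ M * v.q ^ i * (c * (v.q : ℝ) ^ (-i)) := by
    rw [abs_mul]
    exact mul_le_mul (w.abs_A_le.trans hi) h.1 (abs_nonneg _)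
      ((Real.rpow_nonneg w.q_pos'.le _).trans hi)
  have h2 : |w.B * (v.q * y - v.r)| ≤ M * v.q ^ j * (c * (v.q : ℝ) ^ (-j)) := by
    rw [abs_mul]
    exact mul_le_mul (w.abs_B_le.trans hj) h.2 (abs_nonneg _)
      ((Real.rpow_nonneg w.q_pos'.le _).trans hj)
  have e1 : M * v.q ^ i * (c * (v.q : ℝ) ^ (-i)) = M * c := by
    rw [Real.rpow_neg hq.le]; field_simp
  have e2 : M * v.q ^ j * (c * (v.q : ℝ) ^ (-j)) = M * c := by
    rw [Real.rpow_neg hq.le]; field_simp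
  rw [e1] at h1
  rw [e2] at h2
  linarith [abs_add_le (w.A * (v.q * x - v.p)) (w.B * (v.q * y - v.r))]

theorem q_mul_abs_form_le_of_near {c x y : ℝ} (h : WeightedNear i j c v.q v.p v.r x y) :
    v.q * |v.form x y| ≤ 2 * c := by
  have h1 := form_mul_q (v := v) (w := v) x y
  rw [v.on_line', sub_zero] at h1
  have h2 := abs_mul_add_mul_le (v := v) (w := v) (M := 1) (by simp) (by simp) h
  rw [← h1, abs_mul, abs_of_pos v.q_pos'] at h2
  linarith

theorem q_mul_abs_form_le {c ρ x y x' y' : ℝ} (h : WeightedNear i j c v.q v.p v.r x' y')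
    (hx : |x - x'| ≤ 2 * ρ) (hy : |y - y'| ≤ 2 * ρ) :
    v.q * |v.form x y| ≤ 2 * c + 4 * ρ * v.height := by
  have h1 := q_mul_abs_form_le_of_near h
  have h2 : v.form x y = v.form x' y' + (v.A * (x - x') + v.B * (y - y')) := by
    simp only [form]; ring
  have hρ : 0 ≤ 2 * ρ := (abs_nonneg _).trans hx
  have hA : |v.A * (x - x')| ≤ max |(v.A : ℝ)| |(v.B : ℝ)| * (2 * ρ) := by
    rw [abs_mul]; gcongr; exact le_max_left _ _
  have hB : |v.B * (y - y')| ≤ max |(v.A : ℝ)| |(v.B : ℝ)| * (2 * ρ) := by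
    rw [abs_mul]; gcongr; exact le_max_right _ _
  have h3 : |v.form x y| ≤ |v.form x' y'| + 4 * ρ * max |(v.A : ℝ)| |(v.B : ℝ)| := by
    rw [h2]
    linarith [abs_add_le (v.form x' y') (v.A * (x - x') + v.B * (y - y')),
      abs_add_le (v.A * (x - x')) (v.B * (y - y'))]
  have h4 := mul_le_mul_of_nonneg_left h3 v.q_pos'.le
  rw [height]
  linarith

theorem excess_rpow_le (hi : 0 < i) (hj : 0 < j) (hij : i + j = 1) {t : ℝ} (ht : min i j ≤ t) :
    v.excess ^ min i j ≤ (v.q : ℝ) ^ t :=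
  (Real.rpow_le_rpow v.excess_pos.le (v.excess_le hi hj hij) (lt_min hi hj).le).trans
    (Real.rpow_le_rpow_of_exponent_le v.one_le_q ht)

/-! ### Comparing points of the same class and scale -/

/-- `v` belongs to the `k`-th class of points to be treated with balls of radius `ρ`. -/
structure AtScale (v : RatPointOnLine i j) (c σ R ρ : ℝ) (k : ℕ) : Prop where
  le_excess : 2 ^ k ≤ v.excess
  excess_lt : v.excess < 2 ^ (k + 1)
  le_scale : ρ * v.height ≤ σ * max 1 (c * v.excess ^ min i j)
  scale_le : σ * max 1 (c * v.excess ^ min i j) ≤ R * ρ * v.height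

variable {c σ R ρ : ℝ} {k : ℕ}

theorem AtScale.excess_le_two_mul (hv : v.AtScale c σ R ρ k) (hw : w.AtScale c σ R ρ k) :
    v.excess ≤ 2 * w.excess := by
  have h1 := hv.excess_lt
  have h2 := hw.le_excess
  rw [pow_succ] at h1
  linarith

theorem AtScale.max_le_two_mul (hi : 0 < i) (hj : 0 < j) (hij : i + j = 1) (hc : 0 < c)
    (hv : v.AtScale c σ R ρ k) (hw : w.AtScale c σ R ρ k) :
    max 1 (c * v.excess ^ min i j) ≤ 2 * max 1 (c * w.excess ^ min i j) := by
  have h1 : v.excess ^ min i j ≤ 2 * w.excess ^ min i j := by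
    refine (Real.rpow_le_rpow v.excess_pos.le (hv.excess_le_two_mul hw) (lt_min hi hj).le).trans ?_
    rw [Real.mul_rpow zero_le_two w.excess_pos.le]
    refine mul_le_mul_of_nonneg_right ?_ (Real.rpow_nonneg w.excess_pos.le _)
    conv_rhs => rw [← Real.rpow_one 2]
    exact Real.rpow_le_rpow_of_exponent_le one_le_two ((min_le_left _ _).trans (by linarith))
  refine max_le ?_ ?_
  · linarith [le_max_left 1 (c * w.excess ^ min i j)]
  · have := mul_le_mul_of_nonneg_left h1 hc.le
    linarith [le_max_right 1 (c * w.excess ^ min i j)]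

theorem AtScale.height_le (hi : 0 < i) (hj : 0 < j) (hij : i + j = 1) (hc : 0 < c) (hσ : 0 < σ)
    (hρ : 0 < ρ) (hv : v.AtScale c σ R ρ k) (hw : w.AtScale c σ R ρ k) :
    v.height ≤ 2 * R * w.height := by
  have h1 := hv.le_scale.trans (mul_le_mul_of_nonneg_left (hv.max_le_two_mul hi hj hij hc hw) hσ.le)
  have h2 := hw.scale_le
  exact le_of_mul_le_mul_left (by linarith) hρ

/-- Excess times height is q^(1+max(i,j)). The excesses agree up to 2 and the heights up to 2R, and
the exponent is at least 1. -/
theorem AtScale.q_le (hi : 0 < i) (hj : 0 < j) (hij : i + j = 1) (hc : 0 < c) (hσ : 0 < σ)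
    (hρ : 0 < ρ) (hR : 1 ≤ R) (hv : v.AtScale c σ R ρ k) (hw : w.AtScale c σ R ρ k) :
    (v.q : ℝ) ≤ 4 * R * w.q := by
  have h1 : (v.q : ℝ) ^ (1 + max i j) ≤ 4 * R * (w.q : ℝ) ^ (1 + max i j) := by
    rw [← v.excess_mul_height, ← w.excess_mul_height]
    have := mul_le_mul (hv.excess_le_two_mul hw) (hv.height_le hi hj hij hc hσ hρ hw)
      v.height_pos.le (by have := w.excess_pos; positivity)
    linarith
  have he : 0 < 1 + max i j := by have := lt_max_of_lt_left hi (b := i) (c := j); linarith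
  have hw0 := w.q_pos'
  refine (Real.rpow_le_rpow_iff v.q_pos'.le (by positivity) he).1 (h1.trans ?_)
  rw [Real.mul_rpow (by positivity) hw0.le]
  refine mul_le_mul_of_nonneg_right ?_ (by positivity)
  conv_lhs => rw [← Real.rpow_one (4 * R)]
  exact Real.rpow_le_rpow_of_exponent_le (by linarith)
    (by have := hi.trans_le (le_max_left i j); linarith)

theorem rpow_le_mul_rpow {a b M t : ℝ} (ha : 0 ≤ a) (hb : 0 ≤ b) (hM : 1 ≤ M) (h : a ≤ M * b)
    (ht : 0 ≤ t) (ht' : t ≤ 1) : a ^ t ≤ M * b ^ t := by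
  refine (Real.rpow_le_rpow ha h ht).trans ?_
  rw [Real.mul_rpow (by linarith) hb]
  refine mul_le_mul_of_nonneg_right ?_ (Real.rpow_nonneg hb _)
  conv_rhs => rw [← Real.rpow_one M]
  exact Real.rpow_le_rpow_of_exponent_le hM ht'

/-- The determinant of two lines in the same class is small. -/
theorem AtScale.excess_mul_abs_det_le (hij : i + j = 1) {M : ℝ}
    (hM : 0 ≤ M) (hv : v.AtScale c σ R ρ k) (hw : w.AtScale c σ R ρ k)
    (hMi : (v.q : ℝ) ^ i ≤ M * w.q ^ i) (hMj : (v.q : ℝ) ^ j ≤ M * w.q ^ j) :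
    v.excess * |(v.A * w.B - w.A * v.B : ℝ)| ≤ 3 * M * w.q := by
  have hK := v.excess_pos
  have hw0 := w.q_pos'
  have hq : (w.q : ℝ) ^ i * (w.q : ℝ) ^ j = w.q := by
    rw [← Real.rpow_add hw0, hij, Real.rpow_one]
  have htri : |(v.A * w.B - w.A * v.B : ℝ)| ≤ |(v.A : ℝ)| * |(w.B : ℝ)| +
      |(w.A : ℝ)| * |(v.B : ℝ)| := by
    rw [← abs_mul, ← abs_mul]; exact abs_sub _ _
  have hvK := v.excess_mul_max
  have hwK : v.excess * max |(w.A : ℝ)| |(w.B : ℝ)| ≤ 2 * (w.q : ℝ) ^ max i j := by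
    rw [← w.excess_mul_max, ← mul_assoc]
    exact mul_le_mul_of_nonneg_right (hv.excess_le_two_mul hw) (zero_le_one.trans w.one_le_max)
  have hvA := v.abs_A_le
  have hvB := v.abs_B_le
  have hwA := w.abs_A_le
  have hwB := w.abs_B_le
  have h1 := mul_le_mul_of_nonneg_left htri hK.le
  -- The coefficient with the larger weight is bounded by q^max(i,j)/K, which saves a factor K; the
  -- trivial bound on the other coefficient then gives products of size q/K.
  rcases le_total j i with h | h
  · rw [max_eq_left h] at hvK hwK
    have e1 : v.excess * |(v.A : ℝ)| ≤ M * (w.q : ℝ) ^ i :=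
      (mul_le_mul_of_nonneg_left (le_max_left _ _) hK.le).trans (hvK.le.trans hMi)
    have e2 : v.excess * |(w.A : ℝ)| ≤ 2 * (w.q : ℝ) ^ i :=
      (mul_le_mul_of_nonneg_left (le_max_left _ _) hK.le).trans hwK
    have e3 := mul_le_mul e1 hwB (abs_nonneg _) (by positivity)
    have e4 := mul_le_mul e2 (hvB.trans hMj) (abs_nonneg _) (by positivity)
    linear_combination h1 + e3 + e4 + 3 * M * hq
  · rw [max_eq_right h] at hvK hwK
    have e1 : v.excess * |(v.B : ℝ)| ≤ M * (w.q : ℝ) ^ j :=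
      (mul_le_mul_of_nonneg_left (le_max_right _ _) hK.le).trans (hvK.le.trans hMj)
    have e2 : v.excess * |(w.B : ℝ)| ≤ 2 * (w.q : ℝ) ^ j :=
      (mul_le_mul_of_nonneg_left (le_max_right _ _) hK.le).trans hwK
    have e3 := mul_le_mul e1 hwA (abs_nonneg _) (by positivity)
    have e4 := mul_le_mul e2 (hvA.trans hMi) (abs_nonneg _) (by positivity)
    linear_combination h1 + e3 + e4 + 3 * M * hq

end RatPointOnLine

/-! ### Collinearity of dangerous points -/

/-- `(x, y)` has no approximations of size `c` with denominator below `N`. -/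
def WeightedBadBelow (i j c : ℝ) (N : ℕ) (x y : ℝ) : Prop :=
  ∀ q : ℕ, 0 < q → q < N → ∀ p r : ℤ, ¬ WeightedNear i j c q p r x y

theorem WeightedBadBelow.not_near_int {i j c : ℝ} {N : ℕ} {x y : ℝ}
    (h : WeightedBadBelow i j c N x y) {Q : ℤ} (hQ : Q ≠ 0) (hN : |(Q : ℝ)| < N) (p r : ℤ) :
    ¬ (|Q * x - p| ≤ c * |(Q : ℝ)| ^ (-i) ∧ |Q * y - r| ≤ c * |(Q : ℝ)| ^ (-j)) := by
  rintro ⟨h1, h2⟩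
  have habs : ((Q.natAbs : ℕ) : ℝ) = |(Q : ℝ)| := by
    rw [Nat.cast_natAbs, Int.cast_abs]
  rw [← habs] at h1 h2 hN
  have hpos := Int.natAbs_pos.2 hQ
  have hlt : Q.natAbs < N := by exact_mod_cast hN
  rcases Int.natAbs_eq Q with he | he
  · have he' : (Q : ℝ) = (Q.natAbs : ℝ) :=
      (congrArg (Int.cast : ℤ → ℝ) he).trans (Int.cast_natCast _)
    refine h _ hpos hlt p r ⟨?_, ?_⟩
    · have e : |(Q.natAbs : ℝ) * x - p| = |Q * x - p| := by rw [← he']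
      exact e.trans_le h1
    · have e : |(Q.natAbs : ℝ) * y - r| = |Q * y - r| := by rw [← he']
      exact e.trans_le h2
  · have he' : (Q : ℝ) = -(Q.natAbs : ℝ) := by exact_mod_cast he
    refine h _ hpos hlt (-p) (-r) ⟨?_, ?_⟩
    · convert h1 using 1; rw [← abs_neg, he']; push_cast; congr 1; ring
    · convert h2 using 1; rw [← abs_neg, he']; push_cast; congr 1; ring

theorem int_eq_zero_of_abs_lt_one {n : ℤ} (h : |(n : ℝ)| < 1) : n = 0 := by
  have : |n| < 1 := by exact_mod_cast h
  exact Int.abs_lt_one_iff.1 this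

namespace RatPointOnLine

/-- Since K ≥ 1 and s ≤ t, K^s D^t ≤ (KD)^t ≤ 3M q^t: the smallness of the determinant D pays for
the factor K^s in the error. The constants multiply to 60 M²σ < 1. -/
theorem le_mul_rpow_neg {M D K q s t z c σ : ℝ} (hM : 1 ≤ M) (hD : 0 < D)
    (hK : 1 ≤ K) (hq : 0 < q) (hst : s ≤ t) (ht : 0 ≤ t) (ht' : t ≤ 1) (hc : 0 < c)
    (hσ : 100 * M ^ 2 * σ ≤ 1) (hDK : K * D ≤ 3 * M * q)
    (hz : z ≤ 2 * M * (10 * σ * c * K ^ s) * q ^ (-t)) : z ≤ c * D ^ (-t) := by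
  have hK0 : 0 < K := by linarith
  have h1 : K ^ s * D ^ t ≤ 3 * M * q ^ t := by
    calc K ^ s * D ^ t ≤ K ^ t * D ^ t := by
          gcongr
      _ = (K * D) ^ t := (Real.mul_rpow hK0.le hD.le).symm
      _ ≤ 3 * M * q ^ t := rpow_le_mul_rpow (by positivity) hq.le (by linarith) hDK ht ht'
  rw [Real.rpow_neg hD.le, ← div_eq_mul_inv, le_div_iff₀ (by positivity)]
  rw [Real.rpow_neg hq.le] at hz
  have hqt : 0 < q ^ t := by positivity
  have hDt : 0 < D ^ t := by positivity
  by_cases hσ0 : σ ≤ 0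
  · have hz0 : z ≤ 0 := by
      refine hz.trans ?_
      have : 0 ≤ 2 * M * (10 * c * K ^ s) * (q ^ t)⁻¹ := by positivity
      nlinarith
    nlinarith
  push Not at hσ0
  calc z * D ^ t ≤ 2 * M * (10 * σ * c * K ^ s) * (q ^ t)⁻¹ * D ^ t := by gcongr
    _ = 20 * M * σ * c * (q ^ t)⁻¹ * (K ^ s * D ^ t) := by ring
    _ ≤ 20 * M * σ * c * (q ^ t)⁻¹ * (3 * M * q ^ t) := by gcongr
    _ = 60 * M ^ 2 * σ * c := by field_simp; ring
    _ ≤ c := by nlinarith [sq_nonneg M, mul_pos hσ0 hc]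

variable {i j : ℝ} {v w : RatPointOnLine i j} {c σ R ρ : ℝ} {k : ℕ}

/-- Points in the same class near a ball lie on a common line. -/
theorem AtScale.on_line_of_near (hi : 0 < i) (hj : 0 < j) (hij : i + j = 1) (hc : 0 < c)
    (hcσ : c ≤ σ) (hρ : 0 < ρ) (hR : 1 ≤ R) (hσ : 100 * (4 * R) ^ 2 * σ ≤ 1)
    (hv : v.AtScale c σ R ρ k) (hw : w.AtScale c σ R ρ k) {x y x' y' : ℝ}
    (hx : |x - x'| ≤ 2 * ρ) (hy : |y - y'| ≤ 2 * ρ)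
    (hv' : WeightedNear i j c v.q v.p v.r x' y') (hw' : WeightedNear i j c w.q w.p w.r x y)
    (hbad : WeightedBadBelow i j c w.q x y) :
    v.A * w.p + v.B * w.r + v.C * w.q = 0 := by
  have hσ0 : 0 < σ := hc.trans_le hcσ
  have hvw := hv.q_le hi hj hij hc hσ0 hρ hR hw
  have hwv := hw.q_le hi hj hij hc hσ0 hρ hR hv
  set M := 4 * R with hMdef
  have hM : 4 ≤ M := by linarith
  have hM1 : 1 ≤ M := by linarith
  have hσM : 100 * M * σ ≤ 1 := by
    refine le_trans ?_ hσ
    gcongr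
    nlinarith
  have hσ1 : σ ≤ 1 := by nlinarith
  have hi1 : i ≤ 1 := by linarith
  have hj1 : j ≤ 1 := by linarith
  have hvq := v.q_pos'
  have hwq := w.q_pos'
  have hMi := rpow_le_mul_rpow hvq.le hwq.le hM1 hvw hi.le hi1
  have hMj := rpow_le_mul_rpow hvq.le hwq.le hM1 hvw hj.le hj1
  have hfv := q_mul_abs_form_le hv' hx hy
  have hfw := q_mul_abs_form_le_of_near hw'
  set K := v.excess with hK
  have hK1 : 1 ≤ K := v.one_le_excess
  have hscale := hv.le_scale
  -- For small excess, ρH ≤ σ already makes the integer `v.A * w.p + v.B * w.r + v.C * w.q` smaller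
  -- than 1. For large excess the intersection of the two lines is used.
  rcases le_or_gt (c * K ^ min i j) 1 with hcase | hcase
  · rw [max_eq_left hcase, mul_one] at hscale
    apply int_eq_zero_of_abs_lt_one
    push_cast
    have h1 := abs_mul_add_mul_le (v := w) (w := v) hMi hMj hw'
    rw [← form_mul_q] at h1
    have h2 : w.q * |v.form x y| ≤ M * (2 * c + 4 * σ) := by
      calc w.q * |v.form x y| ≤ M * v.q * |v.form x y| := by gcongr
        _ = M * (v.q * |v.form x y|) := by ring
        _ ≤ M * (2 * c + 4 * σ) := by gcongr; linarith
    have h3 : |(w.q * v.form x y : ℝ)| ≤ M * (2 * c + 4 * σ) := by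
      rwa [abs_mul, abs_of_pos hwq]
    have h4 := abs_sub_abs_le_abs_sub (v.A * w.p + v.B * w.r + v.C * w.q : ℝ) (w.q * v.form x y)
    rw [abs_sub_comm] at h4
    nlinarith
  · rw [max_eq_right hcase.le] at hscale
    -- Of the 10, 4 comes from the displacement term 4ρH and 6 generously absorbs 2c, because 1 <
    -- cK^s ≤ σK^s with s = min(i, j).
    set E := 10 * σ * c * K ^ min i j with hE
    have hKs : 0 < K ^ min i j := by positivity
    have hE0 : 0 < E := by positivity
    have hcE : 2 * c ≤ 6 * σ * c * K ^ min i j := by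
      have h1 : c * K ^ min i j ≤ σ * K ^ min i j := by gcongr
      have h2 : c * 1 ≤ c * (σ * K ^ min i j) := by gcongr; linarith
      have h3 : 0 < c * (σ * K ^ min i j) := by positivity
      linarith
    have hfvE : |v.form x y| ≤ M * E / w.q := by
      rw [le_div_iff₀ hwq]
      calc |v.form x y| * w.q ≤ |v.form x y| * (M * v.q) := by gcongr
        _ = M * (v.q * |v.form x y|) := by ring
        _ ≤ M * E := by gcongr; linarith
    have hfwE : |w.form x y| ≤ E / w.q := by
      rw [le_div_iff₀ hwq]
      have : 0 < σ * c * K ^ min i j := by positivity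
      linarith
    have hdiv : ∀ {t t' a b : ℝ}, t + t' = 1 → |a| ≤ (w.q : ℝ) ^ t' → |b| ≤ M * (w.q : ℝ) ^ t' →
        |a * v.form x y - b * w.form x y| ≤ 2 * M * E * (w.q : ℝ) ^ (-t) := by
      intro t t' a b ht ha hb
      have e : (w.q : ℝ) ^ t' / w.q = (w.q : ℝ) ^ (-t) := by
        rw [← Real.rpow_sub_one hwq.ne']; congr 1; linarith
      calc |a * v.form x y - b * w.form x y| ≤ |a| * |v.form x y| + |b| * |w.form x y| := by
            rw [← abs_mul, ← abs_mul]; exact abs_sub _ _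
        _ ≤ (w.q : ℝ) ^ t' * (M * E / w.q) + M * (w.q : ℝ) ^ t' * (E / w.q) := by gcongr
        _ = 2 * M * E * ((w.q : ℝ) ^ t' / w.q) := by ring
        _ = _ := by rw [e]
    -- Cramer's rule: if Q ≠ 0, the lines meet at (P/Q, S/Q).
    set Q : ℤ := v.A * w.B - w.A * v.B with hQ
    set P : ℤ := w.C * v.B - v.C * w.B with hP
    set S : ℤ := v.C * w.A - w.C * v.A with hS
    have hQP : |Q * x - P| ≤ 2 * M * E * (w.q : ℝ) ^ (-i) := by
      have := hdiv hij w.abs_B_le (v.abs_B_le.trans hMj)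
      convert this using 2
      simp only [hQ, hP, form]; push_cast; ring
    have hQS : |Q * y - S| ≤ 2 * M * E * (w.q : ℝ) ^ (-j) := by
      have := hdiv (by linarith : j + i = 1) w.abs_A_le (v.abs_A_le.trans hMi)
      rw [← abs_neg] at this
      convert this using 2
      simp only [hQ, hS, form]; push_cast; ring
    have hdet : K * |(Q : ℝ)| ≤ 3 * M * w.q := by
      have := hv.excess_mul_abs_det_le hij (by linarith) hw hMi hMj
      rw [hQ]; push_cast; exact this
    -- Otherwise the intersection point has denominator |Q| ≤ 3M `w.q`/K < `w.q` and approximates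
    -- (x, y) within c, against `hbad`. The inequality K > 3M follows from 1 < cK and 3Mc ≤ 3Mσ < 1.
    have hQ0 : Q = 0 := by
      by_contra hne
      have hQpos : 0 < |(Q : ℝ)| := abs_pos.2 (by exact_mod_cast hne)
      have hK3 : 3 * M < K := by
        have h1 : K ^ min i j ≤ K := by
          conv_rhs => rw [← Real.rpow_one K]
          exact Real.rpow_le_rpow_of_exponent_le hK1 ((min_le_left _ _).trans hi1)
        have h2 : M * c ≤ M * σ := by gcongr
        refine lt_of_mul_lt_mul_left ?_ hc.le
        have h3 : c * K ^ min i j ≤ c * K := by gcongr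
        linarith
      refine hbad.not_near_int hne ?_ P S ⟨?_, ?_⟩
      · refine lt_of_mul_lt_mul_left (hdet.trans_lt ?_) (zero_le_one.trans hK1)
        gcongr
      · exact le_mul_rpow_neg hM1 hQpos hK1 hwq (min_le_left _ _) hi.le hi1 hc hσ hdet hQP
      · exact le_mul_rpow_neg hM1 hQpos hK1 hwq (min_le_right _ _) hj.le hj1 hc hσ hdet hQS
    have hsmall : ∀ t : ℝ, K ^ min i j ≤ M * (w.q : ℝ) ^ t → 2 * M * E * (w.q : ℝ) ^ (-t) < 1 := by
      intro t ht
      rw [Real.rpow_neg hwq.le, ← div_eq_mul_inv, div_lt_one (by positivity), hE]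
      have h0 : 0 < (w.q : ℝ) ^ t := by positivity
      have hc1 : c ≤ 1 := by linarith
      calc 2 * M * (10 * σ * c * K ^ min i j) ≤ 2 * M * (10 * σ * 1 * (M * (w.q : ℝ) ^ t)) := by
            gcongr
        _ = 20 * M ^ 2 * σ * (w.q : ℝ) ^ t := by ring
        _ < 1 * (w.q : ℝ) ^ t := by gcongr; linarith
        _ = _ := one_mul _
    have hP0 : P = 0 := by
      apply int_eq_zero_of_abs_lt_one
      rw [hQ0, Int.cast_zero, zero_mul, zero_sub, abs_neg] at hQP
      exact hQP.trans_lt (hsmall i ((v.excess_rpow_le hi hj hij (min_le_left _ _)).trans hMi))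
    have hS0 : S = 0 := by
      apply int_eq_zero_of_abs_lt_one
      rw [hQ0, Int.cast_zero, zero_mul, zero_sub, abs_neg] at hQS
      exact hQS.trans_lt (hsmall j ((v.excess_rpow_le hi hj hij (min_le_right _ _)).trans hMj))
    -- All three minors vanish, so the two lines coincide and the point of `w` lies on both.
    have hline := w.on_line
    rcases w.ne_zero with h | h
    · refine (mul_eq_zero.1 (?_ : w.A * _ = 0)).resolve_left h
      linear_combination v.A * hline - w.r * hQ0 + w.q * hS0
    · refine (mul_eq_zero.1 (?_ : w.B * _ = 0)).resolve_left h
      linear_combination v.B * hline + w.p * hQ0 - w.q * hP0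

/-- A maximum dominates the geometric mean of 1 and cK^s. One bound thus yields both smallness in c
and geometric decay in k for the strip widths. -/
theorem sqrt_mul_pow_le {s K : ℝ} (hs : 0 ≤ s) (hc : 0 < c) (hK : 2 ^ k ≤ K) :
    √c * ((2 : ℝ) ^ (s / 2)) ^ k ≤ max 1 (c * K ^ s) := by
  have h1 : (√c * ((2 : ℝ) ^ (s / 2)) ^ k) ^ 2 ≤ c * K ^ s := by
    rw [mul_pow, Real.sq_sqrt hc.le]
    refine mul_le_mul_of_nonneg_left ?_ hc.le
    rw [← pow_mul, mul_comm k 2, pow_mul, ← Real.rpow_natCast _ 2, ← Real.rpow_mul zero_le_two]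
    refine le_trans (le_of_eq ?_) (Real.rpow_le_rpow (by positivity) hK hs)
    rw [← Real.rpow_natCast_mul zero_le_two, ← Real.rpow_mul_natCast zero_le_two]
    congr 1; push_cast; ring
  rcases le_total (√c * ((2 : ℝ) ^ (s / 2)) ^ k) 1 with h | h
  · exact h.trans (le_max_left _ _)
  · exact le_max_of_le_right (by nlinarith)

/-- By collinearity the integer term disappears, so q|form| is O(c) without the displacement ρH.
Dividing by ρH, which is at least σ max(1, cK^s)/R, gives the relative width. -/
theorem AtScale.abs_form_le (hi : 0 < i) (hj : 0 < j) (hij : i + j = 1) (hc : 0 < c)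
    (hcσ : c ≤ σ) (hρ : 0 < ρ) (hR : 1 ≤ R) (hσ : 100 * (4 * R) ^ 2 * σ ≤ 1)
    (hv : v.AtScale c σ R ρ k) (hw : w.AtScale c σ R ρ k) {x y x' y' : ℝ}
    (hx : |x - x'| ≤ 2 * ρ) (hy : |y - y'| ≤ 2 * ρ)
    (hv' : WeightedNear i j c v.q v.p v.r x' y') (hw' : WeightedNear i j c w.q w.p w.r x y)
    (hbad : WeightedBadBelow i j c w.q x y) :
    |v.form x y| ≤ 32 * R ^ 3 / σ * √c * (((2 : ℝ) ^ (min i j / 2))⁻¹) ^ k * ρ *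
      max |(v.A : ℝ)| |(v.B : ℝ)| := by
  have hσ0 : 0 < σ := hc.trans_le hcσ
  have hvw := hv.q_le hi hj hij hc hσ0 hρ hR hw
  have hvq := v.q_pos'
  have hwq := w.q_pos'
  have hM1 : 1 ≤ 4 * R := by linarith
  have hMi := rpow_le_mul_rpow hvq.le hwq.le hM1 hvw hi.le (by linarith)
  have hMj := rpow_le_mul_rpow hvq.le hwq.le hM1 hvw hj.le (by linarith)
  have hN : (v.A * w.p + v.B * w.r + v.C * w.q : ℝ) = 0 := by
    exact_mod_cast hv.on_line_of_near hi hj hij hc hcσ hρ hR hσ hw hx hy hv' hw' hbad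
  have h1 := abs_mul_add_mul_le (v := w) (w := v) hMi hMj hw'
  rw [← form_mul_q, hN, sub_zero, abs_mul, abs_of_pos hwq] at h1
  have h2 : v.q * |v.form x y| ≤ 32 * R ^ 2 * c := by
    calc v.q * |v.form x y| ≤ 4 * R * w.q * |v.form x y| := by gcongr
      _ = 4 * R * (w.q * |v.form x y|) := by ring
      _ ≤ 4 * R * (2 * (4 * R) * c) := by gcongr
      _ = _ := by ring
  refine le_of_mul_le_mul_left (h2.trans ?_) hvq
  have h3 := (mul_le_mul_of_nonneg_left (sqrt_mul_pow_le (lt_min hi hj).le hc hv.le_excess)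
    hσ0.le).trans hv.scale_le
  have hpow : 0 < ((2 : ℝ) ^ (min i j / 2)) ^ k := by positivity
  calc 32 * R ^ 2 * c = 32 * R ^ 2 / σ * √c * (((2 : ℝ) ^ (min i j / 2))⁻¹) ^ k *
        (σ * (√c * ((2 : ℝ) ^ (min i j / 2)) ^ k)) := by
        rw [inv_pow]
        conv_lhs => rw [← Real.mul_self_sqrt hc.le]
        field_simp
    _ ≤ 32 * R ^ 2 / σ * √c * (((2 : ℝ) ^ (min i j / 2))⁻¹) ^ k * (R * ρ * v.height) := by gcongr
    _ = _ := by rw [height]; ring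

end RatPointOnLine

/-! ### One covering strip per ball and class -/

/-- In every ball and for every class, the points to be avoided are covered by one strip. -/
theorem exists_line_cover {i j c σ R ρ : ℝ} (hi : 0 < i) (hj : 0 < j) (hij : i + j = 1)
    (hc : 0 < c) (hcσ : c ≤ σ) (hρ : 0 < ρ) (hR : 1 ≤ R) (hσ : 100 * (4 * R) ^ 2 * σ ≤ 1)
    (k : ℕ) (x₀ y₀ : ℝ) : ∃ l : ℝ × ℝ × ℝ, (l.1 ≠ 0 ∨ l.2.1 ≠ 0) ∧
      ∀ w : RatPointOnLine i j, w.AtScale c σ R ρ k → ∀ x y, |x - x₀| ≤ ρ → |y - y₀| ≤ ρ →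
        WeightedNear i j c w.q w.p w.r x y → WeightedBadBelow i j c w.q x y →
        |l.1 * x + l.2.1 * y + l.2.2| ≤
          32 * R ^ 3 / σ * √c * (((2 : ℝ) ^ (min i j / 2))⁻¹) ^ k * ρ * max |l.1| |l.2.1| := by
  by_cases h : ∃ v : RatPointOnLine i j, v.AtScale c σ R ρ k ∧ ∃ x y, |x - x₀| ≤ ρ ∧
      |y - y₀| ≤ ρ ∧ WeightedNear i j c v.q v.p v.r x y
  · obtain ⟨v, hv, x', y', hx', hy', hv'⟩ := h
    -- The line of any one such point serves; badness is needed only for the point (x, y) being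
    -- covered.
    refine ⟨(v.A, v.B, v.C), by simpa using v.ne_zero, fun w hw x y hx hy hw' hbad => ?_⟩
    refine hv.abs_form_le hi hj hij hc hcσ hρ hR hσ hw ?_ ?_ hv' hw' hbad
    · rw [abs_le] at *; constructor <;> linarith
    · rw [abs_le] at *; constructor <;> linarith
  · refine ⟨(1, 0, 0), by simp, fun w hw x y hx hy hw' _ => absurd ⟨w, hw, x, y, hx, hy, hw'⟩ h⟩

/-- In every ball, the inhomogeneous points to be avoided are covered by one strip. -/
theorem exists_line_cover_inhom {i j c c' σ R ρ : ℝ} (hi : 0 < i) (hj : 0 < j) (hij : i + j = 1)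
    (hρ : 0 < ρ) (hR : 1 ≤ R) (hc1 : c ≤ 1) (hc'0 : 0 < c') (hc' : 4 * R * c' < c) (hσ0 : 0 < σ)
    (hσ : 4 * R * σ < c) (γ δ x₀ y₀ : ℝ) : ∃ l : ℝ × ℝ × ℝ, (l.1 ≠ 0 ∨ l.2.1 ≠ 0) ∧
      ∀ (q : ℕ) (p r : ℤ), 0 < q → ρ * (q : ℝ) ^ (1 + max i j) ≤ σ →
        σ ≤ R * ρ * (q : ℝ) ^ (1 + max i j) → ∀ x y, |x - x₀| ≤ ρ → |y - y₀| ≤ ρ →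
        WeightedNear i j c' q (p + γ) (r + δ) x y →
        (∀ N, WeightedBadBelow i j c N x y) →
        |l.1 * x + l.2.1 * y + l.2.2| ≤ c' * R / σ * ρ * max |l.1| |l.2.1| := by
  by_cases h : ∃ (q : ℕ) (p r : ℤ), 0 < q ∧ ρ * (q : ℝ) ^ (1 + max i j) ≤ σ ∧
      σ ≤ R * ρ * (q : ℝ) ^ (1 + max i j) ∧ ∃ x y, |x - x₀| ≤ ρ ∧ |y - y₀| ≤ ρ ∧
      WeightedNear i j c' q (p + γ) (r + δ) x y
  · obtain ⟨q, p, r, hq, hq1, hq2, x', y', hx', hy', hn'⟩ := h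
    have hq0 : (0 : ℝ) < q := by exact_mod_cast hq
    have hq1' : (1 : ℝ) ≤ q := by exact_mod_cast hq
    -- It suffices that all these approximations come from a single box: its thinner side, of
    -- half-width at most c'q^(-1-max(i,j)), gives the strip.
    suffices H : ∀ (q₂ : ℕ) (p₂ r₂ : ℤ), 0 < q₂ → ρ * (q₂ : ℝ) ^ (1 + max i j) ≤ σ →
        σ ≤ R * ρ * (q₂ : ℝ) ^ (1 + max i j) → ∀ x y, |x - x₀| ≤ ρ → |y - y₀| ≤ ρ →
        WeightedNear i j c' q₂ (p₂ + γ) (r₂ + δ) x y →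
        (∀ N, WeightedBadBelow i j c N x y) → WeightedNear i j c' q (p + γ) (r + δ) x y by
      have hwidth : c' * (q : ℝ) ^ (-(max i j)) ≤ c' * R / σ * ρ * q := by
        rw [Real.rpow_add hq0, Real.rpow_one] at hq2
        rw [Real.rpow_neg hq0.le]
        have : 0 < (q : ℝ) ^ max i j := by positivity
        rw [← div_eq_mul_inv, div_le_iff₀ this]
        calc c' = c' / σ * σ := by field_simp
          _ ≤ c' / σ * (R * ρ * (q * (q : ℝ) ^ max i j)) := by gcongr
          _ = _ := by ring
      rcases le_total j i with hji | hji
      · refine ⟨(q, 0, -(p + γ)), Or.inl hq0.ne', fun q₂ p₂ r₂ a1 a2 a3 x y a4 a5 a6 a7 => ?_⟩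
        have h1 := (H q₂ p₂ r₂ a1 a2 a3 x y a4 a5 a6 a7).1
        rw [max_eq_left hji] at hwidth
        simpa [abs_of_pos hq0, max_eq_left hq0.le, sub_eq_add_neg] using h1.trans hwidth
      · refine ⟨(0, q, -(r + δ)), Or.inr hq0.ne', fun q₂ p₂ r₂ a1 a2 a3 x y a4 a5 a6 a7 => ?_⟩
        have h1 := (H q₂ p₂ r₂ a1 a2 a3 x y a4 a5 a6 a7).2
        rw [max_eq_right hji] at hwidth
        simpa [abs_of_pos hq0, max_eq_right hq0.le, sub_eq_add_neg] using h1.trans hwidth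
    intro q₂ p₂ r₂ hq₂ hqσ hqσ' x y hx hy hn hbad
    have hq₂0 : (0 : ℝ) < q₂ := by exact_mod_cast hq₂
    have hq₂1 : (1 : ℝ) ≤ q₂ := by exact_mod_cast hq₂
    have he : 0 < 1 + max i j := by have := hi.trans_le (le_max_left i j); linarith
    have hle : ∀ {a b : ℝ}, 0 < a → 0 < b → ρ * a ^ (1 + max i j) ≤ σ →
        σ ≤ R * ρ * b ^ (1 + max i j) → a ≤ R * b := by
      intro a b ha hb h1 h2
      refine (Real.rpow_le_rpow_iff ha.le (by positivity) he).1 ?_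
      rw [Real.mul_rpow (by linarith) hb.le]
      have h3 : a ^ (1 + max i j) ≤ R * b ^ (1 + max i j) :=
        le_of_mul_le_mul_left (by linarith) hρ
      refine h3.trans (mul_le_mul_of_nonneg_right ?_ (by positivity))
      conv_lhs => rw [← Real.rpow_one R]
      exact Real.rpow_le_rpow_of_exponent_le hR (by linarith [hi.trans_le (le_max_left i j)])
    have hq12 := hle hq0 hq₂0 hq1 hqσ'
    have hq21 := hle hq₂0 hq0 hqσ hq2
    set Q : ℤ := q₂ - q with hQ
    have hQ1 : |(Q : ℝ)| ≤ R * q := by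
      rw [hQ]; push_cast; rw [abs_le]; constructor <;> nlinarith
    have hQ2 : |(Q : ℝ)| ≤ R * q₂ := by
      rw [hQ]; push_cast; rw [abs_le]; constructor <;> nlinarith
    -- the difference of two inhomogeneous approximations is a homogeneous one
    have key : ∀ {t z z' θ : ℝ} {n n₂ : ℤ}, 0 ≤ t → t ≤ max i j → t ≤ 1 → |z - z'| ≤ 2 * ρ →
        |q * z' - (n + θ)| ≤ c' * (q : ℝ) ^ (-t) → |q₂ * z - (n₂ + θ)| ≤ c' * (q₂ : ℝ) ^ (-t) →
        |Q * z - (n₂ - n : ℤ)| < 1 ∧ (Q ≠ 0 → |Q * z - (n₂ - n : ℤ)| ≤ c * |(Q : ℝ)| ^ (-t)) := by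
      intro t z z' θ n n₂ ht ht' ht1 hz h1 h2
      have h3 : |Q * z - (n₂ - n : ℤ)| ≤
          c' * (q : ℝ) ^ (-t) + c' * (q₂ : ℝ) ^ (-t) + 2 * ρ * q := by
        have e : Q * z - (n₂ - n : ℤ) =
            (q₂ * z - (n₂ + θ)) - (q * z' - (n + θ)) - q * (z - z') := by
          rw [hQ]; push_cast; ring
        have h4 : |(q : ℝ) * (z - z')| ≤ q * (2 * ρ) := by
          rw [abs_mul, abs_of_pos hq0]; gcongr
        rw [e]
        linarith [abs_sub (q₂ * z - (n₂ + θ) - (q * z' - (n + θ))) (q * (z - z')),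
          abs_sub (q₂ * z - (n₂ + θ)) (q * z' - (n + θ))]
      have hρq : ρ * q * (q : ℝ) ^ t ≤ σ := by
        refine le_trans ?_ hq1
        rw [Real.rpow_add hq0, Real.rpow_one, mul_assoc]
        gcongr
      have hρq1 : ρ * q ≤ σ := by
        refine le_trans ?_ hρq
        exact le_mul_of_one_le_right (by positivity) (Real.one_le_rpow hq1' ht)
      constructor
      · have e1 : (q : ℝ) ^ (-t) ≤ 1 := Real.rpow_le_one_of_one_le_of_nonpos hq1' (by linarith)
        have e2 : (q₂ : ℝ) ^ (-t) ≤ 1 := Real.rpow_le_one_of_one_le_of_nonpos hq₂1 (by linarith)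
        nlinarith
      · intro hQ0
        have hQpos : 0 < |(Q : ℝ)| := abs_pos.2 (by exact_mod_cast hQ0)
        rw [Real.rpow_neg (abs_nonneg _), ← div_eq_mul_inv, le_div_iff₀ (by positivity)]
        have f1 := RatPointOnLine.rpow_le_mul_rpow hQpos.le hq0.le hR hQ1 ht ht1
        have f2 := RatPointOnLine.rpow_le_mul_rpow hQpos.le hq₂0.le hR hQ2 ht ht1
        rw [Real.rpow_neg hq0.le, Real.rpow_neg hq₂0.le] at h3
        have hqt : 0 < (q : ℝ) ^ t := by positivity
        have hqt₂ : 0 < (q₂ : ℝ) ^ t := by positivity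
        calc |Q * z - (n₂ - n : ℤ)| * |(Q : ℝ)| ^ t
            ≤ (c' * ((q : ℝ) ^ t)⁻¹ + c' * ((q₂ : ℝ) ^ t)⁻¹ + 2 * ρ * q) * |(Q : ℝ)| ^ t := by
              gcongr
          _ = c' * ((q : ℝ) ^ t)⁻¹ * |(Q : ℝ)| ^ t + c' * ((q₂ : ℝ) ^ t)⁻¹ * |(Q : ℝ)| ^ t +
              2 * ρ * q * |(Q : ℝ)| ^ t := by ring
          _ ≤ c' * ((q : ℝ) ^ t)⁻¹ * (R * (q : ℝ) ^ t) +
              c' * ((q₂ : ℝ) ^ t)⁻¹ * (R * (q₂ : ℝ) ^ t) + 2 * ρ * q * (R * (q : ℝ) ^ t) := by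
              gcongr
          _ = 2 * R * c' + 2 * R * (ρ * q * (q : ℝ) ^ t) := by field_simp; ring
          _ ≤ 2 * R * c' + 2 * R * σ := by gcongr
          _ ≤ c := by linarith
    have hX := key hi.le (le_max_left _ _) (by linarith)
      (by rw [abs_le] at *; constructor <;> linarith : |x - x'| ≤ 2 * ρ) hn'.1 hn.1
    have hY := key hj.le (le_max_right _ _) (by linarith)
      (by rw [abs_le] at *; constructor <;> linarith : |y - y'| ≤ 2 * ρ) hn'.2 hn.2
    -- A nonzero difference of denominators would give a homogeneous approximation of size c. Once Q
    -- = 0, the differences of the numerators are integers below 1.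
    have hQ0 : Q = 0 := by
      by_contra hne
      obtain ⟨N, hN⟩ := exists_nat_gt |(Q : ℝ)|
      exact (hbad N).not_near_int hne hN _ _ ⟨hX.2 hne, hY.2 hne⟩
    have hp : p₂ - p = 0 := int_eq_zero_of_abs_lt_one (by simpa [hQ0, abs_sub_comm] using hX.1)
    have hr : r₂ - r = 0 := int_eq_zero_of_abs_lt_one (by simpa [hQ0, abs_sub_comm] using hY.1)
    obtain rfl : p₂ = p := by linarith
    obtain rfl : r₂ = r := by linarith
    obtain rfl : q₂ = q := by omega
    exact hn
  · exact ⟨(1, 0, 0), by simp, fun q p r h0 h1 h2 x y hx hy hn _ =>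
      absurd ⟨q, p, r, h0, h1, h2, x, y, hx, hy, hn⟩ h⟩

/-! ### Smallness of constants, scales, and assembly -/

theorem exists_pos_rpow_le {η G ε : ℝ} (hη : 0 < η) (hG : 0 < G) (hε : 0 < ε) :
    ∃ t > 0, ∀ u, 0 ≤ u → u ≤ t → (G * u) ^ η ≤ ε := by
  refine ⟨ε ^ (1 / η) / G, by positivity, fun u hu hut => ?_⟩
  calc (G * u) ^ η ≤ (ε ^ (1 / η)) ^ η := by
        refine Real.rpow_le_rpow (by positivity) ?_ hη.le
        rw [le_div_iff₀ hG] at hut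
        linarith
    _ = ε := by rw [← Real.rpow_mul hε.le, one_div_mul_cancel hη.ne', Real.rpow_one]

theorem tsum_geometric_rpow_le {η G θ ε : ℝ} (hη : 0 < η) (hG : 0 ≤ G) (hθ : 0 < θ) (hθ' : θ < 1)
    (hε : G ^ η ≤ (1 - θ ^ η) * ε) :
    ∑' k : ℕ, ENNReal.ofReal ((G * θ ^ k) ^ η) ≤ ENNReal.ofReal ε := by
  have h1 : θ ^ η < 1 := Real.rpow_lt_one hθ.le hθ' hη
  have h0 : 0 ≤ θ ^ η := by positivity
  have hterm : ∀ k : ℕ, (G * θ ^ k) ^ η = G ^ η * (θ ^ η) ^ k := fun k => by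
    rw [Real.mul_rpow hG (by positivity), ← Real.rpow_natCast_mul hθ.le,
      ← Real.rpow_mul_natCast hθ.le, mul_comm η]
  simp_rw [hterm]
  rw [← ENNReal.ofReal_tsum_of_nonneg (fun k => by positivity)
    ((summable_geometric_of_lt_one h0 h1).mul_left _), tsum_mul_left, tsum_geometric_of_lt_one h0 h1]
  refine ENNReal.ofReal_le_ofReal ?_
  rw [← div_eq_mul_inv, div_le_iff₀ (by linarith)]
  linarith

/-- The radii of a play form a geometric progression of ratio 1/R, so every critical radius up to
the initial one is reached within a factor R. -/
theorem exists_scale {R ρ S : ℝ} (hR : 1 < R) (hρ : 0 < ρ) (hS : 0 < S) (hSρ : S ≤ ρ) :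
    ∃ m : ℕ, R⁻¹ ^ m * ρ ≤ S ∧ S ≤ R * (R⁻¹ ^ m * ρ) := by
  obtain ⟨n, hn, hn'⟩ := exists_nat_pow_near ((one_le_div hS).2 hSρ) hR
  have hR0 : 0 < R := by linarith
  rw [le_div_iff₀ hS] at hn
  rw [div_lt_iff₀ hS] at hn'
  refine ⟨n + 1, ?_, ?_⟩
  · rw [inv_pow, inv_mul_le_iff₀ (by positivity)]
    exact hn'.le
  · have e : R * (R⁻¹ ^ (n + 1) * ρ) = (R ^ n)⁻¹ * ρ := by rw [inv_pow, pow_succ]; field_simp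
    rw [e, le_inv_mul_iff₀ (by positivity)]
    exact hn

theorem inhomBad_of_not_near {i j γ δ c : ℝ} (hi : 0 < i) (hj : 0 < j) (hc : 0 < c)
    {x : EuclideanSpace ℝ (Fin 2)}
    (h : ∀ q : ℕ, 0 < q → ∀ p r : ℤ, ¬ WeightedNear i j c q (p + γ) (r + δ) (x 0) (x 1)) :
    x ∈ inhomBad i j γ δ := by
  refine ⟨min (c ^ (1 / i)) (c ^ (1 / j)), by positivity, fun q hq => ?_⟩
  have hq0 : (0 : ℝ) < q := by exact_mod_cast hq
  have key : ∀ {t z : ℝ}, 0 < t → c * (q : ℝ) ^ (-t) < z → c ^ (1 / t) / q < z ^ (1 / t) := by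
    intro t z ht hz
    have e : c ^ (1 / t) / q = (c * (q : ℝ) ^ (-t)) ^ (1 / t) := by
      rw [Real.mul_rpow hc.le (by positivity), ← Real.rpow_mul hq0.le]
      have : -t * (1 / t) = -1 := by field_simp
      rw [this, Real.rpow_neg_one, div_eq_mul_inv]
    rw [e]
    exact Real.rpow_lt_rpow (by positivity) hz (by positivity)
  have hn := h q hq (round (q * x 0 - γ)) (round (q * x 1 - δ))
  rw [WeightedNear, not_and_or, not_le, not_le] at hn
  rcases hn with hn | hn
  · refine lt_max_of_lt_left (lt_of_le_of_lt (b := c ^ (1 / i) / q) ?_ (key hi ?_))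
    · gcongr; exact min_le_left _ _
    · rwa [distNearestInt, sub_sub, add_comm]
  · refine lt_max_of_lt_right (lt_of_le_of_lt (b := c ^ (1 / j) / q) ?_ (key hj ?_))
    · gcongr; exact min_le_right _ _
    · rwa [distNearestInt, sub_sub, add_comm]

/-- Since the height is at least q, and q ≥ K^min(i,j), no critical radius exceeds σ. Hence every
rational point is treated at some stage once σ is at most the initial radius. -/
theorem RatPointOnLine.scale_le {i j c σ : ℝ} (hi : 0 < i) (hj : 0 < j) (hij : i + j = 1)
    (hc1 : c ≤ 1) (hσ : 0 ≤ σ) (v : RatPointOnLine i j) :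
    σ * max 1 (c * v.excess ^ min i j) / v.height ≤ σ := by
  rw [div_le_iff₀ v.height_pos]
  refine mul_le_mul_of_nonneg_left (max_le (v.one_le_q.trans v.q_le_height) ?_) hσ
  have h0 : 0 ≤ v.excess ^ min i j := Real.rpow_nonneg v.excess_pos.le _
  have h1 := v.excess_rpow_le hi hj hij (t := 1) ((min_le_left _ _).trans (by linarith))
  rw [Real.rpow_one] at h1
  nlinarith [v.q_le_height]

/-- Induction on the denominator: covering a point of denominator q requires badness only below q,
which is the induction hypothesis. -/
theorem weightedBadBelow_of_forall_scale {i j c σ R ρ₀ x y : ℝ} (hi : 0 < i) (hj : 0 < j)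
    (hij : i + j = 1) (hc1 : c ≤ 1) (hσ : 0 < σ) (hR : 1 < R) (hρ₀ : 0 < ρ₀)
    (hσρ : σ ≤ ρ₀)
    (h : ∀ (m k : ℕ) (w : RatPointOnLine i j), w.AtScale c σ R (R⁻¹ ^ m * ρ₀) k →
      WeightedNear i j c w.q w.p w.r x y → ¬ WeightedBadBelow i j c w.q x y) (N : ℕ) :
    WeightedBadBelow i j c N x y := by
  induction N with
  | zero => exact fun q _ hq => absurd hq (Nat.not_lt_zero _)
  | succ N ih =>
    intro q hq hqN p r hn
    rcases Nat.lt_succ_iff_lt_or_eq.1 hqN with hlt | rfl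
    · exact ih q hq hlt p r hn
    obtain ⟨v, rfl, rfl, rfl⟩ := exists_ratPointOnLine hij hq p r
    obtain ⟨k, hk, hk'⟩ := exists_nat_pow_near v.one_le_excess one_lt_two
    have hS : 0 < σ * max 1 (c * v.excess ^ min i j) / v.height := by
      have := v.height_pos
      have : 0 < max 1 (c * v.excess ^ min i j) := lt_max_of_lt_left one_pos
      positivity
    obtain ⟨m, hm, hm'⟩ := exists_scale hR hρ₀ hS ((v.scale_le hi hj hij hc1 hσ.le).trans hσρ)
    rw [le_div_iff₀ v.height_pos] at hm
    rw [div_le_iff₀ v.height_pos] at hm'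
    exact h m k v ⟨hk, hk', hm, hm'⟩ hn ih

open SchmidtGame in
theorem theorem3 (i j : ℝ) (hi : 0 < i) (hi' : i < 1) (hj : 0 < j) (hj' : j < 1)
    (hij : i + j = 1) (γ δ : ℝ) :
    SchmidtGame.IsWinning (30 * Real.sqrt 2)⁻¹ (inhomBad i j γ δ) := by
  intro β hβ hβ'
  have hα : 0 < (30 * √2)⁻¹ := by positivity
  have hα' : (30 * √2)⁻¹ ≤ 1 / 40 := by
    have : (4 / 3 : ℝ) ≤ √2 := Real.le_sqrt_of_sq_le (by norm_num)
    rw [one_div]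
    exact inv_anti₀ (by norm_num) (by linarith)
  set α := (30 * √2)⁻¹
  have hαβ : α * β < 1 := by nlinarith
  set R := (α * β)⁻¹ with hRdef
  have hR : 1 < R := (one_lt_inv₀ (by positivity)).2 hαβ
  have hR0 : 0 < R := by linarith
  obtain ⟨η, hη, hRη⟩ : ∃ η : ℝ, 0 < η ∧ R ^ η = 5 / 4 := by
    have hlog := Real.log_pos hR
    refine ⟨Real.log (5 / 4) / Real.log R, div_pos (Real.log_pos (by norm_num)) hlog, ?_⟩
    rw [Real.rpow_def_of_pos hR0, mul_div_cancel₀ _ hlog.ne', Real.exp_log (by norm_num)]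
  -- The constants below depend on the first ball through σ, σ' ≤ `b.radius`. They are chosen in the
  -- order σ, c, σ', c', since the inhomogeneous boxes must be small relative to c.
  refine isWinningPair_of_forall_ball fun b => ?_
  have hb := b.radius_pos
  obtain ⟨σ, hσ0, hσb, hσ⟩ : ∃ σ > 0, σ ≤ b.radius ∧ 100 * (4 * R) ^ 2 * σ ≤ 1 := by
    refine ⟨min b.radius (1 / (100 * (4 * R) ^ 2)), by positivity, min_le_left _ _, ?_⟩
    rw [← le_div_iff₀' (by positivity)]
    exact min_le_right _ _
  have hσ1 : σ ≤ 1 := by nlinarith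
  set θ := ((2 : ℝ) ^ (min i j / 2))⁻¹ with hθdef
  have hs : 0 < min i j := lt_min hi hj
  have hθ0 : 0 < θ := by positivity
  have hθ1 : θ < 1 := inv_lt_one_of_one_lt₀ (Real.one_lt_rpow one_lt_two (by linarith))
  have hθη : θ ^ η < 1 := Real.rpow_lt_one hθ0.le hθ1 hη
  obtain ⟨c, hc0, hcσ, hcsum⟩ : ∃ c > 0, c ≤ σ ∧
      ∑' k : ℕ, ENNReal.ofReal ((8 * (32 * R ^ 3 / σ * √c * θ ^ k)) ^ η) ≤
        ENNReal.ofReal (1 / 24) := by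
    obtain ⟨t, ht, h⟩ := exists_pos_rpow_le (G := 8 * (32 * R ^ 3 / σ))
      (ε := (1 - θ ^ η) * (1 / 24)) hη (by positivity) (by nlinarith)
    refine ⟨min σ (t ^ 2), by positivity, min_le_left _ _, ?_⟩
    have h1 : √(min σ (t ^ 2)) ≤ t := Real.sqrt_le_iff.2 ⟨ht.le, min_le_right _ _⟩
    have h2 := tsum_geometric_rpow_le hη (by positivity) hθ0 hθ1 (h _ (Real.sqrt_nonneg _) h1)
    convert h2 using 5
    ring
  have hc1 : c ≤ 1 := hcσ.trans hσ1
  obtain ⟨σ', hσ'0, hσ'b, hσ'⟩ : ∃ σ' > 0, σ' ≤ b.radius ∧ 4 * R * σ' < c := by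
    refine ⟨min b.radius (c / (8 * R)), by positivity, min_le_left _ _, ?_⟩
    calc 4 * R * min b.radius (c / (8 * R)) ≤ 4 * R * (c / (8 * R)) := by
          gcongr; exact min_le_right _ _
      _ = c / 2 := by field_simp; ring
      _ < c := by linarith
  obtain ⟨c', hc'0, hc', hc'η⟩ : ∃ c' > 0, 4 * R * c' < c ∧ (8 * (c' * R / σ')) ^ η ≤ 1 / 24 := by
    obtain ⟨t, ht, h⟩ := exists_pos_rpow_le (G := 8 * (R / σ')) (ε := 1 / 24) hη (by positivity)
      (by norm_num)
    refine ⟨min t (c / (8 * R)), by positivity, ?_, ?_⟩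
    · calc 4 * R * min t (c / (8 * R)) ≤ 4 * R * (c / (8 * R)) := by
            gcongr; exact min_le_right _ _
        _ = c / 2 := by field_simp; ring
        _ < c := by linarith
    · convert h (min t (c / (8 * R))) (by positivity) (min_le_left _ _) using 2
      ring
  choose L hL hcover using fun (b' : Ball 2) (k : ℕ) =>
    exists_line_cover hi hj hij hc0 hcσ b'.radius_pos hR.le hσ k (b'.center 0) (b'.center 1)
  choose L' hL' hcover' using fun b' : Ball 2 =>
    exists_line_cover_inhom hi hj hij b'.radius_pos hR.le hc1 hc'0 hc' hσ'0 hσ' γ δ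
      (b'.center 0) (b'.center 1)
  -- `Unit` indexes the inhomogeneous strip and `ℕ` the excess classes; each family uses 1/24 of the
  -- budget 1/12.
  obtain ⟨strat, hstrat⟩ := exists_strategy_avoiding_strips (ι := Unit ⊕ ℕ)
    (τ := Sum.elim (fun _ => c' * R / σ') fun k => 32 * R ^ 3 / σ * √c * θ ^ k)
    (L := fun b' => Sum.elim (fun _ => L' b') (L b')) hα hα' hβ hβ' hη hRη
    (by rintro b' (u | k); exacts [hL' b', hL b' k])
    (by rintro (u | k) <;> simp only [Sum.elim_inl, Sum.elim_inr] <;> positivity)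
    (by
      rw [Summable.tsum_sum ENNReal.summable ENNReal.summable, tsum_fintype]
      simp only [Finset.univ_unique, Finset.sum_singleton, Sum.elim_inl, Sum.elim_inr]
      refine (add_le_add (ENNReal.ofReal_le_ofReal hc'η) hcsum).trans ?_
      rw [← ENNReal.ofReal_add (by norm_num) (by norm_num)]
      norm_num
      rw [ENNReal.ofReal_div_of_pos (by norm_num)]
      simp)
  refine ⟨strat, fun B hB0 hB => ?_⟩
  obtain ⟨hA, havoid⟩ := hstrat B hB
  refine ⟨hA, ?_⟩
  obtain ⟨x, hx, hx'⟩ := exists_iInter_eq_singleton hα hβ hαβ hA hB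
  refine ⟨x, ?_, hx, hx'⟩
  have hxB : ∀ n, x ∈ (B n).toSet := Set.mem_iInter.1 (hx ▸ Set.mem_singleton x)
  have hrad : ∀ m, (B m).radius = R⁻¹ ^ m * b.radius := fun m => by
    rw [radius_eq_of_isReply hA hB, hRdef, inv_inv, hB0]
  -- Homogeneous badness comes first because the inhomogeneous cover is valid only at such points.
  have hbad : ∀ N, WeightedBadBelow i j c N (x 0) (x 1) := by
    refine weightedBadBelow_of_forall_scale hi hj hij hc1 hσ0 hR hb hσb
      fun m k w hw hn hbad => ?_
    rw [← hrad] at hw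
    exact absurd (hcover (B m) k w hw _ _ (abs_apply_sub_le (hxB m) 0)
      (abs_apply_sub_le (hxB m) 1) hn hbad) (not_le.2 (havoid x hxB m (.inr k)))
  refine inhomBad_of_not_near hi hj hc'0 fun q hq p r hn => ?_
  have hq1 : (1 : ℝ) ≤ q := by exact_mod_cast hq
  have hqe : 1 ≤ (q : ℝ) ^ (1 + max i j) :=
    Real.one_le_rpow hq1 (by linarith [hi.trans_le (le_max_left i j)])
  have hqe0 : 0 < (q : ℝ) ^ (1 + max i j) := by linarith
  obtain ⟨m, hm, hm'⟩ := exists_scale hR hb (div_pos hσ'0 hqe0)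
    ((div_le_self hσ'0.le hqe).trans hσ'b)
  rw [← hrad, le_div_iff₀ hqe0] at hm
  rw [← hrad, div_le_iff₀ hqe0] at hm'
  exact absurd (hcover' (B m) q p r hq hm hm' _ _ (abs_apply_sub_le (hxB m) 0)
    (abs_apply_sub_le (hxB m) 1) hn hbad) (not_le.2 (havoid x hxB m (.inl ())))
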